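/- Let $n\ge 1$, let $\Omega\subset\mathbb{R}^n$ be a bounded domain (nonempty, open and connected; no regularity of $\partial\Omega$ is needed), and let $\Omega'$ be a domain with $\overline{\Omega'}\subset\Omega$ and with $C^{1,\beta}$ boundary $\Gamma:=\partial\Omega'$ for some $\beta\in(0,1)$. Let $Q\in L^1(\Gamma,\mathcal{H}^{n-1})$, and let $v\in L^1(\Omega)$ be a weak solution of $$-\Delta v=Q\,\mathcal{H}^{n-1}\llcorner\Gamma\ \text{ in }\Omega,\qquad v=0\ \text{ on }\partial\Omega,$$ that is, $-\int_\Omega v\,\Delta\phi\,dx=\int_\Gamma Q\,\phi\,d\mathcal{H}^{n-1}$ for every $\phi\in C^2(\overline\Omega)$ with $\phi|_{\partial\Omega}=0$. Then $v\notin C^1(\Omega)$ (no function in $C^1(\Omega)$ agrees with $v$ almost everywhere in $\Omega$), unless $Q=0$ $\mathcal{H}^{n-1}$-almost everywhere on $\Gamma$. -/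

import Mathlib

open MeasureTheory
open scoped NNReal Laplacian

noncomputable section

/-- The Euclidean product `ℝⁿ⁻¹ × ℝ`, in which graphs over `ℝⁿ⁻¹` live. -/
abbrev GraphSpace (n : ℕ) : Type := WithLp 2 (EuclideanSpace ℝ (Fin (n - 1)) × ℝ)

/-- `D ⊆ ℝⁿ` has `C^{1,β}` boundary: near each boundary point, after an orthogonal change of
coordinates `R`, the set `D` is the region strictly below the graph of a `C^{1,β}` function `f`
(a `C¹` function whose derivative is `β`-Hölder continuous), inside an open cylinder `U × V`. -/
def HasC1HolderBoundary {n : ℕ} (β : ℝ≥0) (D : Set (EuclideanSpace ℝ (Fin n))) : Prop :=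
  ∀ x₀ ∈ frontier D,
    ∃ (R : EuclideanSpace ℝ (Fin n) ≃ₗᵢ[ℝ] GraphSpace n)
      (U : Set (EuclideanSpace ℝ (Fin (n - 1)))) (V : Set ℝ)
      (f : EuclideanSpace ℝ (Fin (n - 1)) → ℝ),
      IsOpen U ∧ IsOpen V ∧ (R x₀).fst ∈ U ∧ (R x₀).snd ∈ V ∧
      ContDiffOn ℝ 1 f U ∧ (∃ C : ℝ≥0, HolderOnWith C β (fderiv ℝ f) U) ∧
      ∀ x, (R x).fst ∈ U → (R x).snd ∈ V → (x ∈ D ↔ (R x).snd < f (R x).fst)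

/-- `φ ∈ C²(Ω̄)`: `φ` is `C²` in the open set `Ω`, continuous up to the boundary, and its
derivatives of order at most two extend continuously from `Ω` to `Ω̄`. -/
def IsC2UpToBoundary {n : ℕ} (Ω : Set (EuclideanSpace ℝ (Fin n)))
    (φ : EuclideanSpace ℝ (Fin n) → ℝ) : Prop :=
  ContDiffOn ℝ 2 φ Ω ∧ ContinuousOn φ (closure Ω) ∧
    ∀ k : ℕ, k ≤ 2 → ∃ g : EuclideanSpace ℝ (Fin n) →
        ContinuousMultilinearMap ℝ (fun _ : Fin k => EuclideanSpace ℝ (Fin n)) ℝ,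
      ContinuousOn g (closure Ω) ∧ Set.EqOn g (iteratedFDeriv ℝ k φ) Ω

/-- `v ∈ L¹(Ω)` is a weak solution of `-Δ v = Q 𝓗ⁿ⁻¹ ⌞ Γ` in `Ω`, `v = 0` on `∂Ω`.
Here `μHE[n - 1]` is the `(n-1)`-dimensional Hausdorff measure, normalised to agree with Lebesgue
measure on `ℝⁿ⁻¹`. -/
def IsWeakSolution {n : ℕ} (Ω Γ : Set (EuclideanSpace ℝ (Fin n)))
    (Q v : EuclideanSpace ℝ (Fin n) → ℝ) : Prop :=
  IntegrableOn v Ω volume ∧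
    ∀ φ : EuclideanSpace ℝ (Fin n) → ℝ, IsC2UpToBoundary Ω φ → (∀ x ∈ frontier Ω, φ x = 0) →
      -∫ x in Ω, v x * Laplacian.laplacian φ x = ∫ x in Γ, Q x * φ x ∂μHE[n - 1]

end

/-! ### Cutoffs, their Laplacians, and integration by parts. -/

section TestFunctions

open Set Filter Topology Metric

variable {E : Type*} [NormedAddCommGroup E] [InnerProductSpace ℝ E] [FiniteDimensional ℝ E]

/-! A `C¹` representative `w` is tested at a point `x` of `Γ` against a cutoff `φ` at scale `r`.
Affine functions are harmonic, so the first-order Taylor polynomial of `w` at `x` can be subtracted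
from `w` in `∫ w Δφ`. What remains is `o(r)` on the ball, while `|Δφ| ≤ M / r²` and the ball has
volume of order `rⁿ`, so the volume side is `o(rⁿ⁻¹)` (`eventually_abs_integral_mul_laplacian_le`).

On the other side `Γ` has measure comparable to `rⁿ⁻¹` in balls of radius `r`
(`HasC1HolderBoundary.exists_density_bounds`). If `x` is a Lebesgue point of `Q`, then `|∫ Q φ|` is
at least a constant times `|Q x| rⁿ⁻¹`, up to `o(rⁿ⁻¹)` (`abs_mul_measureReal_le`). Dividing by
`rⁿ⁻¹` and letting `r → 0` gives `Q x = 0`; almost every point of `Γ` is a Lebesgue point. -/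

theorem laplacian_comp_homothety {ψ : E → ℝ} (hψ : ContDiff ℝ 2 ψ) (a : E) (c : ℝ) (x : E) :
    Laplacian.laplacian (fun y => ψ (c • (y - a))) x =
      c ^ 2 * Laplacian.laplacian ψ (c • (x - a)) := by
  have h1 : (fun y => ψ (c • (y - a))) =
      fun y => (ψ ∘ (c • ContinuousLinearMap.id ℝ E)) (y - a) := by
    ext y; simp
  simp only [InnerProductSpace.laplacian_eq_iteratedFDeriv_stdOrthonormalBasis]
  rw [Finset.mul_sum]
  refine Finset.sum_congr rfl fun i _ => ?_
  rw [h1, iteratedFDeriv_comp_sub,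
    ContinuousLinearMap.iteratedFDeriv_comp_right _ hψ _ (by norm_num)]
  have h2 : ∀ u : Fin 2 → E, (fun i => (c • ContinuousLinearMap.id ℝ E) (u i)) =
      fun i => c • u i := by
    intro u; ext i; simp
  rw [ContinuousMultilinearMap.compContinuousLinearMap_apply, h2,
    ContinuousMultilinearMap.map_smul_univ]
  simp

theorem continuous_laplacian {φ : E → ℝ} (hφ : ContDiff ℝ 2 φ) :
    Continuous (Laplacian.laplacian φ) := by
  rw [InnerProductSpace.laplacian_eq_iteratedFDeriv_stdOrthonormalBasis]
  refine continuous_finsetSum _ fun i _ => ?_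
  exact (ContinuousMultilinearMap.apply ℝ (fun _ : Fin 2 => E) ℝ _).continuous.comp
    (hφ.continuous_iteratedFDeriv (by norm_num))

theorem support_laplacian_subset (φ : E → ℝ) :
    Function.support (Laplacian.laplacian φ) ⊆ tsupport φ := by
  intro x hx
  by_contra h
  refine hx ?_
  rw [notMem_tsupport_iff_eventuallyEq] at h
  have := (InnerProductSpace.laplacian_congr_nhds h).eq_of_nhds
  rw [this]
  have := congrFun (InnerProductSpace.laplacian_const (E := E) (c := (0 : ℝ))) x
  exact this

theorem hasCompactSupport_laplacian {φ : E → ℝ} (hφ : HasCompactSupport φ) :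
    HasCompactSupport (Laplacian.laplacian φ) :=
  hφ.mono' (support_laplacian_subset φ)

/-- Rescaled cutoff functions, with the scale-invariant bound for their Laplacians. -/
theorem exists_cutoff_laplacian_le (E : Type*) [NormedAddCommGroup E] [InnerProductSpace ℝ E]
    [FiniteDimensional ℝ E] :
    ∃ M : ℝ, 0 ≤ M ∧ ∀ (a : E) (r : ℝ), 0 < r → ∃ φ : E → ℝ, ContDiff ℝ 2 φ ∧
      tsupport φ ⊆ closedBall a r ∧ (∀ x, 0 ≤ φ x) ∧ (∀ x, φ x ≤ 1) ∧
      (∀ x ∈ closedBall a (r / 2), φ x = 1) ∧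
      ∀ x, |Laplacian.laplacian φ x| ≤ M / r ^ 2 := by
  let ψ : ContDiffBump (0 : E) := ⟨1 / 2, 1, by norm_num, by norm_num⟩
  have hψ : ContDiff ℝ 2 ψ := ψ.contDiff
  obtain ⟨M, hM⟩ := (hasCompactSupport_laplacian ψ.hasCompactSupport).exists_bound_of_continuous
    (continuous_laplacian hψ)
  refine ⟨M, (norm_nonneg _).trans (hM 0), fun a r hr => ⟨fun y => ψ (r⁻¹ • (y - a)), ?_, ?_,
    fun x => ψ.nonneg, fun x => ψ.le_one, fun x hx => ?_, fun x => ?_⟩⟩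
  · exact hψ.comp (by fun_prop)
  · refine closure_minimal (fun x hx => ?_) isClosed_closedBall
    have : r⁻¹ • (x - a) ∈ ball (0 : E) 1 := by
      rw [← ψ.support_eq]; exact hx
    rw [mem_ball_zero_iff, norm_smul, norm_inv, Real.norm_of_nonneg hr.le,
      inv_mul_lt_iff₀ hr, mul_one] at this
    exact mem_closedBall_iff_norm.2 this.le
  · refine ψ.one_of_mem_closedBall ?_
    rw [mem_closedBall_iff_norm] at hx
    rw [mem_closedBall_zero_iff, norm_smul, norm_inv, Real.norm_of_nonneg hr.le,
      inv_mul_le_iff₀ hr]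
    change _ ≤ r * (1 / 2)
    linarith
  · rw [laplacian_comp_homothety hψ, abs_mul, abs_of_nonneg (by positivity), inv_pow,
      inv_mul_eq_div]
    gcongr
    exact hM _

variable [MeasurableSpace E] [BorelSpace E]

theorem integral_fderiv_apply_eq_zero {G : E → ℝ} (hG : ContDiff ℝ 1 G)
    (hs : HasCompactSupport G) (e : E) : ∫ x, fderiv ℝ G x e = 0 := by
  have hc : Continuous fun x => fderiv ℝ G x e :=
    (hG.continuous_fderiv (by norm_num)).clm_apply continuous_const
  have h := integral_mul_fderiv_eq_neg_fderiv_mul_of_integrable (μ := (volume : Measure E))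
    (f := fun _ : E => (1 : ℝ)) (g := G) (v := e) (by simp)
    (by simpa using hc.integrable_of_hasCompactSupport (hs.fderiv_apply (𝕜 := ℝ) e))
    (by simpa using hG.continuous.integrable_of_hasCompactSupport hs)
    (by simp) (fun x _ => (hG.differentiable (by norm_num)).differentiableAt)
  simpa using h

/-- One integration by parts moves a derivative onto the affine factor and leaves a constant times
the integral of a first derivative of `φ`, which vanishes by compact support. -/
theorem integral_affine_mul_laplacian {φ : E → ℝ} (hφ : ContDiff ℝ 2 φ)
    (hs : HasCompactSupport φ) (c : ℝ) (L : E →L[ℝ] ℝ) :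
    ∫ x, (c + L x) * Laplacian.laplacian φ x = 0 := by
  rw [InnerProductSpace.laplacian_eq_iteratedFDeriv_stdOrthonormalBasis]
  simp only [Finset.mul_sum]
  have key : ∀ e : E,
      Integrable (fun x => (c + L x) * iteratedFDeriv ℝ 2 φ x ![e, e]) ∧
      ∫ x, (c + L x) * iteratedFDeriv ℝ 2 φ x ![e, e] = 0 := by
    intro e
    set G : E → ℝ := fun y => fderiv ℝ φ y e with hGdef
    have hG : ContDiff ℝ 1 G := (hφ.fderiv_right (m := 1) (by norm_num)).clm_apply contDiff_const
    have hGs : HasCompactSupport G := hs.fderiv_apply (𝕜 := ℝ) e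
    have hGc : Continuous fun x => fderiv ℝ G x e :=
      (hG.continuous_fderiv (by norm_num)).clm_apply continuous_const
    have hD : ∀ x, iteratedFDeriv ℝ 2 φ x ![e, e] = fderiv ℝ G x e := by
      intro x
      rw [iteratedFDeriv_two_apply]
      have : DifferentiableAt ℝ (fderiv ℝ φ) x :=
        ((hφ.fderiv_right (m := 1) (by norm_num)).differentiable (by norm_num)).differentiableAt
      rw [hGdef, fderiv_clm_apply this (differentiableAt_const e)]
      simp
    have hI : Integrable (fun x => (c + L x) * fderiv ℝ G x e) :=
      Continuous.integrable_of_hasCompactSupport (by fun_prop)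
        ((hGs.fderiv_apply (𝕜 := ℝ) e).mul_left)
    have hf : ∀ x, fderiv ℝ (fun y => c + L y) x = L := fun x => by
      rw [fderiv_const_add]; exact L.fderiv
    have hGi := hG.continuous.integrable_of_hasCompactSupport (μ := volume) hGs
    have h := integral_mul_fderiv_eq_neg_fderiv_mul_of_integrable (μ := (volume : Measure E))
      (f := fun y : E => c + L y) (g := G) (v := e)
      (by simp only [hf]; exact hGi.const_mul _) hI
      (Continuous.integrable_of_hasCompactSupport (by have := hG.continuous; fun_prop) hGs.mul_left)
      (fun x _ => by fun_prop) (fun x _ => (hG.differentiable (by norm_num)).differentiableAt)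
    simp only [hD]
    refine ⟨hI, ?_⟩
    rw [h]
    simp only [hf]
    rw [integral_const_mul, integral_fderiv_apply_eq_zero (hφ.of_le (by norm_num)) hs]
    simp
  rw [integral_finsetSum _ fun i _ => (key _).1]
  exact Finset.sum_eq_zero fun i _ => (key _).2

/-- A function differentiable at `a` has small weak Laplacian at small scales around `a`. -/
theorem eventually_abs_integral_mul_laplacian_le {w : E → ℝ} {a : E}
    (hw : DifferentiableAt ℝ w a) (hc : ∀ᶠ x in 𝓝 a, ContinuousAt w x) {ε : ℝ} (hε : 0 < ε) :
    ∀ᶠ r in 𝓝[>] (0 : ℝ), ∀ (φ : E → ℝ) (N : ℝ), ContDiff ℝ 2 φ → tsupport φ ⊆ closedBall a r →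
      (∀ x, |Laplacian.laplacian φ x| ≤ N) →
      |∫ x, w x * Laplacian.laplacian φ x| ≤
        ε * r * N * (volume : Measure E).real (closedBall a r) := by
  have h1 := hw.hasFDerivAt.isLittleO.def hε
  obtain ⟨ρ, hρ, hball⟩ := Metric.eventually_nhds_iff_ball.1 (h1.and hc)
  have hev : ∀ᶠ r in 𝓝[>] (0 : ℝ), r ∈ Ioo 0 ρ := Ioo_mem_nhdsGT hρ
  filter_upwards [hev] with r hr φ N hφ hsupp hN
  set L := fderiv ℝ w a
  have hsub : closedBall a r ⊆ ball a ρ := closedBall_subset_ball hr.2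
  have hcs : HasCompactSupport φ :=
    (isCompact_closedBall a r).of_isClosed_subset (isClosed_tsupport φ) hsupp
  have hlap0 : ∀ x ∉ closedBall a r, Laplacian.laplacian φ x = 0 := fun x hx => by
    by_contra h
    exact hx (hsupp (support_laplacian_subset φ h))
  have hlc := continuous_laplacian hφ
  -- Continuity near `a` serves only integrability; the estimate itself uses differentiability at
  -- `a` alone.
  have hwc : ContinuousOn w (closedBall a r) := fun x hx =>
    (hball x (hsub hx)).2.continuousWithinAt
  have hI1 : IntegrableOn (fun x => w x * Laplacian.laplacian φ x) (closedBall a r) :=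
    (hwc.mul hlc.continuousOn).integrableOn_compact (isCompact_closedBall a r)
  have hI2 : IntegrableOn (fun x => ((w a - L a) + L x) * Laplacian.laplacian φ x)
      (closedBall a r) :=
    (show Continuous _ by fun_prop).continuousOn.integrableOn_compact (isCompact_closedBall a r)
  -- The affine function is the Taylor polynomial `w a + L (x - a)`.
  have hz := integral_affine_mul_laplacian hφ hcs (w a - L a) L
  rw [← setIntegral_eq_integral_of_forall_compl_eq_zero (s := closedBall a r)
    fun x hx => by rw [hlap0 x hx, mul_zero]] at hz ⊢
  rw [← sub_zero (∫ x in closedBall a r, w x * Laplacian.laplacian φ x), ← hz,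
    ← integral_sub hI1 hI2, ← Real.norm_eq_abs]
  refine norm_setIntegral_le_of_norm_le_const (isCompact_closedBall a r).measure_lt_top
    fun x hx => ?_
  rw [← sub_mul, norm_mul]
  have h2 := (hball x (hsub hx)).1
  have h3 : w x - (w a - L a + L x) = w x - w a - L (x - a) := by rw [map_sub]; ring
  rw [h3]
  have h4 : ‖x - a‖ ≤ r := mem_closedBall_iff_norm.1 hx
  have := hr.1
  calc _ ≤ (ε * ‖x - a‖) * N := by
        gcongr
        exact hN x
    _ ≤ ε * r * N := by
        have : 0 ≤ N := (abs_nonneg _).trans (hN a)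
        gcongr

end TestFunctions

/-! ### Hausdorff measure of the boundary in small balls. -/

section GraphDensity

open Set Filter Topology Metric

/-- The normalising factor of `μHE[d]` depends only on `d`, so it is the same in `X` and `Y`. -/
theorem LipschitzOnWith.euclideanHausdorffMeasure_image_le {X Y : Type*} [MetricSpace X]
    [MeasurableSpace X] [BorelSpace X] [MetricSpace Y] [MeasurableSpace Y] [BorelSpace Y]
    {K : ℝ≥0} {f : X → Y} {s : Set X} (h : LipschitzOnWith K f s) (d : ℕ) :
    (μHE[d] : Measure Y) (f '' s) ≤ (K : ENNReal) ^ d * (μHE[d] : Measure X) s := by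
  have := h.hausdorffMeasure_image_le (d := d) (by positivity)
  rw [ENNReal.rpow_natCast] at this
  simp only [Measure.euclideanHausdorffMeasure_def, Measure.smul_apply, ENNReal.smul_def,
    smul_eq_mul]
  rw [mul_left_comm]
  gcongr

theorem euclideanHausdorffMeasure_closedBall (d : ℕ) (y : EuclideanSpace ℝ (Fin d)) {r : ℝ}
    (hr : 0 ≤ r) : (μHE[d] : Measure (EuclideanSpace ℝ (Fin d))) (closedBall y r) =
      ENNReal.ofReal (r ^ d * (volume : Measure (EuclideanSpace ℝ (Fin d))).real (ball 0 1)) := by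
  rw [EuclideanSpace.euclideanHausdorffMeasure_eq_volume, Measure.addHaar_closedBall _ _ hr,
    ENNReal.ofReal_mul (by positivity), ofReal_measureReal measure_ball_lt_top.ne]
  simp

variable {n : ℕ}

theorem GraphSpace.norm_fst_le (p : GraphSpace n) : ‖p.fst‖ ≤ ‖p‖ := by
  have := WithLp.prod_norm_sq_eq_of_L2 p
  nlinarith [sq_nonneg ‖p.snd‖, norm_nonneg p, norm_nonneg p.fst]

theorem GraphSpace.norm_le_fst_add_snd (p : GraphSpace n) : ‖p‖ ≤ ‖p.fst‖ + ‖p.snd‖ := by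
  have := WithLp.prod_norm_sq_eq_of_L2 p
  nlinarith [norm_nonneg p.snd, norm_nonneg p, norm_nonneg p.fst,
    mul_nonneg (norm_nonneg p.fst) (norm_nonneg p.snd)]

theorem mem_frontier_iff_of_subgraph {D : Set (EuclideanSpace ℝ (Fin n))}
    {R : EuclideanSpace ℝ (Fin n) ≃ₗᵢ[ℝ] GraphSpace n} {U : Set (EuclideanSpace ℝ (Fin (n - 1)))}
    {V : Set ℝ} {f : EuclideanSpace ℝ (Fin (n - 1)) → ℝ} (hU : IsOpen U) (hV : IsOpen V)
    (hf : ContinuousOn f U)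
    (hD : ∀ x, (R x).fst ∈ U → (R x).snd ∈ V → (x ∈ D ↔ (R x).snd < f (R x).fst))
    {x : EuclideanSpace ℝ (Fin n)} (hxU : (R x).fst ∈ U) (hxV : (R x).snd ∈ V) :
    x ∈ frontier D ↔ (R x).snd = f (R x).fst := by
  have hc1 : Continuous fun z => (R z).fst := (WithLp.continuous_fst 2 _ _).comp R.continuous
  have hc2 : Continuous fun z => (R z).snd := (WithLp.continuous_snd 2 _ _).comp R.continuous
  have evU : ∀ᶠ z in 𝓝 x, (R z).fst ∈ U := hc1.continuousAt.eventually (hU.mem_nhds hxU)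
  have evV : ∀ᶠ z in 𝓝 x, (R z).snd ∈ V := hc2.continuousAt.eventually (hV.mem_nhds hxV)
  have hfc : ContinuousAt (fun z => f (R z).fst) x :=
    ContinuousAt.comp (f := fun z => (R z).fst) (hf.continuousAt (hU.mem_nhds hxU)) hc1.continuousAt
  constructor
  · intro hx
    rcases lt_trichotomy (R x).snd (f (R x).fst) with h | h | h
    · have : ∀ᶠ z in 𝓝 x, z ∈ D := by
        filter_upwards [evU, evV, hc2.continuousAt.eventually_lt hfc h] with z h1 h2 h3
        exact (hD z h1 h2).2 h3
      exact absurd (mem_interior_iff_mem_nhds.2 this) hx.2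
    · exact h
    · have : ∀ᶠ z in 𝓝 x, z ∉ D := by
        filter_upwards [evU, evV, hfc.eventually_lt hc2.continuousAt h] with z h1 h2 h3 h4
        exact absurd ((hD z h1 h2).1 h4) h3.le.not_gt
      have h2 := mem_closure_iff_frequently.1 hx.1
      exact absurd this h2
  · intro h
    refine ⟨?_, fun hi => ?_⟩
    -- A graph point is approached from strictly below, through points of `D`.
    · let γ : ℝ → EuclideanSpace ℝ (Fin n) :=
        fun t => R.symm (WithLp.toLp 2 ((R x).fst, (R x).snd - t))
      have hγ : Continuous γ := by
        refine R.symm.continuous.comp ?_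
        fun_prop
      have hγ0 : γ 0 = x := by
        simp only [γ, sub_zero]
        exact R.symm_apply_apply x
      have ht : Tendsto γ (𝓝[>] 0) (𝓝 x) := by
        have := hγ.tendsto 0
        rw [hγ0] at this
        exact this.mono_left nhdsWithin_le_nhds
      refine mem_closure_of_tendsto ht ?_
      filter_upwards [ht.eventually evV, self_mem_nhdsWithin] with t h1 h2
      have e : R (γ t) = WithLp.toLp 2 ((R x).fst, (R x).snd - t) := R.apply_symm_apply _
      rw [hD _ (by rw [e]; exact hxU) h1, e]
      change (R x).snd - t < f (R x).fst
      have : 0 < t := h2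
      linarith
    · exact absurd ((hD x hxU hxV).1 (interior_subset hi)) (by simp [h])

/-- The boundary of a set with `C^{1,β}` boundary is Ahlfors regular at small scales. -/
theorem HasC1HolderBoundary.exists_density_bounds {β : ℝ≥0} {D : Set (EuclideanSpace ℝ (Fin n))}
    (hD : HasC1HolderBoundary β D) {x : EuclideanSpace ℝ (Fin n)} (hx : x ∈ frontier D) :
    ∃ c C : ℝ, 0 < c ∧ 0 < C ∧ ∀ᶠ r in 𝓝[>] (0 : ℝ),
      ENNReal.ofReal (c * r ^ (n - 1)) ≤ μHE[n - 1] (frontier D ∩ closedBall x r) ∧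
      μHE[n - 1] (frontier D ∩ closedBall x r) ≤ ENNReal.ofReal (C * r ^ (n - 1)) := by
  obtain ⟨R, U, V, f, hU, hV, hxU, hxV, hf, -, hDf⟩ := hD x hx
  have hiff := fun z hz1 hz2 => mem_frontier_iff_of_subgraph (x := z) hU hV hf.continuousOn hDf
    hz1 hz2
  have hfx := (hiff x hxU hxV).1 hx
  set y₀ := (R x).fst with hy₀
  have hfat : ContDiffAt ℝ 1 f y₀ := hf.contDiffAt (hU.mem_nhds hxU)
  obtain ⟨K, s, hs, hKs⟩ := hfat.exists_lipschitzOnWith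
  have hVs : f ⁻¹' V ∈ 𝓝 y₀ := hfat.continuousAt (hV.mem_nhds (hfx ▸ hxV))
  -- Over this ball `f` is `K`-Lipschitz and its graph stays inside the cylinder, hence in the
  -- frontier.
  obtain ⟨δ, hδ, hball⟩ := Metric.mem_nhds_iff.1
    (Filter.inter_mem (Filter.inter_mem hs hVs) (hU.mem_nhds hxU))
  have hc1 : Continuous fun z => (R z).fst := (WithLp.continuous_fst 2 _ _).comp R.continuous
  have hc2 : Continuous fun z => (R z).snd := (WithLp.continuous_snd 2 _ _).comp R.continuous
  obtain ⟨δ', hδ', hball'⟩ := Metric.mem_nhds_iff.1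
    (Filter.inter_mem (hc1.continuousAt (hU.mem_nhds hxU)) (hc2.continuousAt (hV.mem_nhds hxV)))
  let G : EuclideanSpace ℝ (Fin (n - 1)) → EuclideanSpace ℝ (Fin n) :=
    fun y => R.symm (WithLp.toLp 2 (y, f y))
  have hRG : ∀ y, R (G y) = WithLp.toLp 2 (y, f y) := fun y => R.apply_symm_apply _
  have hGx : G y₀ = x := by
    have : WithLp.toLp 2 (y₀, f y₀) = R x := by rw [← hfx]; rfl
    simp only [G, this]
    exact R.symm_apply_apply x
  have hG : LipschitzOnWith (1 + K) G (ball y₀ δ) := by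
    refine LipschitzOnWith.of_dist_le_mul fun y hy z hz => ?_
    simp only [G]
    rw [R.symm.dist_map, dist_eq_norm]
    refine (GraphSpace.norm_le_fst_add_snd _).trans ?_
    have h2 := hKs.dist_le_mul y (hball hy).1.1 z (hball hz).1.1
    rw [dist_eq_norm, dist_eq_norm] at h2
    rw [dist_eq_norm]
    change ‖y - z‖ + ‖f y - f z‖ ≤ _
    push_cast
    linarith
  have hP : LipschitzWith 1 fun z => (R z).fst := by
    refine LipschitzWith.of_dist_le_mul fun y z => ?_
    rw [dist_eq_norm, ← WithLp.sub_fst, ← map_sub, dist_eq_norm, NNReal.coe_one, one_mul,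
      ← R.norm_map (y - z)]
    exact GraphSpace.norm_fst_le _
  set ω := (volume : Measure (EuclideanSpace ℝ (Fin (n - 1)))).real (ball 0 1) with hω
  have hωpos : 0 < ω :=
    ENNReal.toReal_pos (measure_ball_pos _ _ one_pos).ne' measure_ball_lt_top.ne
  have hKpos : (0 : ℝ) < 1 + K := by positivity
  refine ⟨ω / (1 + K) ^ (n - 1), (1 + K) ^ (n - 1) * ω, by positivity, by positivity, ?_⟩
  filter_upwards [Ioo_mem_nhdsGT (lt_min hδ hδ')] with r hr
  have hr0 := hr.1
  have hrδ : r < δ := hr.2.trans_le (min_le_left _ _)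
  have hrδ' : r < δ' := hr.2.trans_le (min_le_right _ _)
  constructor
  -- Lower bound: the projection to `ℝⁿ⁻¹` is 1-Lipschitz, and its image contains a ball of radius
  -- `r / (1 + K)` because the graph map `G` is `(1 + K)`-Lipschitz.
  · have hsub : closedBall y₀ (r / (1 + K)) ⊆
        (fun z => (R z).fst) '' (frontier D ∩ closedBall x r) := by
      intro y hy
      have hle : r / (1 + K) ≤ r := div_le_self hr0.le (by simp)
      have hyb : y ∈ ball y₀ δ := (closedBall_subset_ball (hle.trans_lt hrδ)) hy
      refine ⟨G y, ⟨?_, ?_⟩, congrArg WithLp.fst (hRG y)⟩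
      · rw [hiff _ (by rw [hRG]; exact (hball hyb).2) (by rw [hRG]; exact (hball hyb).1.2), hRG]
        rfl
      · rw [mem_closedBall, ← hGx]
        refine (hG.dist_le_mul y hyb y₀ (mem_ball_self hδ)).trans ?_
        have := mem_closedBall.1 hy
        push_cast
        rwa [le_div_iff₀' hKpos] at this
    have h1 := (hP.lipschitzOnWith (s := frontier D ∩ closedBall x r)
      ).euclideanHausdorffMeasure_image_le (n - 1)
    simp only [ENNReal.coe_one, one_pow, one_mul] at h1
    refine le_trans (le_of_eq ?_) ((measure_mono hsub).trans h1)
    rw [euclideanHausdorffMeasure_closedBall _ _ (by positivity), ← hω, div_pow]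
    congr 1
    ring
  -- Upper bound: this piece of the frontier lies in the `G`-image of a ball of radius `r`.
  · have hsub : frontier D ∩ closedBall x r ⊆ G '' closedBall y₀ r := by
      rintro z ⟨hz, hzr⟩
      have hzb := hball' (closedBall_subset_ball hrδ' hzr)
      refine ⟨(R z).fst, ?_, ?_⟩
      · rw [mem_closedBall] at hzr ⊢
        have := hP.dist_le_mul z x
        simp only [NNReal.coe_one, one_mul] at this
        exact this.trans hzr
      · have : WithLp.toLp 2 ((R z).fst, f (R z).fst) = R z := by
          rw [← (hiff z hzb.1 hzb.2).1 hz]; rfl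
        simp only [G, this]
        exact R.symm_apply_apply z
    refine (measure_mono hsub).trans (((hG.mono (closedBall_subset_ball hrδ)
      ).euclideanHausdorffMeasure_image_le (n - 1)).trans (le_of_eq ?_))
    have hK : ((1 + K : ℝ≥0) : ENNReal) = ENNReal.ofReal (1 + K) := by
      rw [← ENNReal.ofReal_coe_nnreal, NNReal.coe_add, NNReal.coe_one]
    rw [euclideanHausdorffMeasure_closedBall _ _ hr0.le, ← hω, hK, ← ENNReal.ofReal_pow hKpos.le,
      ← ENNReal.ofReal_mul (by positivity)]
    congr 1
    ring

end GraphDensity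

/-! ### Localisation of the weak equation at Lebesgue points. -/

section WeakSolutions

open Set Filter Topology Metric

variable {n : ℕ}

theorem IsC2UpToBoundary.of_contDiff {φ : EuclideanSpace ℝ (Fin n) → ℝ} (hφ : ContDiff ℝ 2 φ)
    (Ω : Set (EuclideanSpace ℝ (Fin n))) : IsC2UpToBoundary Ω φ :=
  ⟨hφ.contDiffOn, hφ.continuous.continuousOn, fun k hk => ⟨iteratedFDeriv ℝ k φ,
    (hφ.continuous_iteratedFDeriv (by exact_mod_cast hk)).continuousOn, fun _ _ => rfl⟩⟩

theorem IsWeakSolution.neg_integral_mul_laplacian {Ω Γ : Set (EuclideanSpace ℝ (Fin n))}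
    {Q v w φ : EuclideanSpace ℝ (Fin n) → ℝ} (hv : IsWeakSolution Ω Γ Q v) (hΩ : IsOpen Ω)
    (hw : w =ᵐ[volume.restrict Ω] v) (hφ : ContDiff ℝ 2 φ) (hsupp : tsupport φ ⊆ Ω) :
    -∫ x, w x * Laplacian.laplacian φ x = ∫ x in Γ, Q x * φ x ∂μHE[n - 1] := by
  rw [← hv.2 φ (.of_contDiff hφ Ω) fun x hx => ?_]
  · rw [← setIntegral_eq_integral_of_forall_compl_eq_zero (s := Ω)]
    · congr 1
      refine integral_congr_ae ?_
      filter_upwards [hw] with x hx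
      rw [hx]
    · intro x hx
      have : Laplacian.laplacian φ x = 0 := by
        by_contra h
        exact hx (hsupp (support_laplacian_subset φ h))
      rw [this, mul_zero]
  · have hxΩ : x ∉ Ω := fun h => by
      rw [hΩ.frontier_eq] at hx
      exact hx.2 h
    exact image_eq_zero_of_notMem_tsupport fun h => hxΩ (hsupp h)

/-- Local finiteness is what the Besicovitch differentiation theorem requires of surface measure. -/
theorem HasC1HolderBoundary.isLocallyFiniteMeasure {β : ℝ≥0} {D : Set (EuclideanSpace ℝ (Fin n))}
    (hD : HasC1HolderBoundary β D) :
    IsLocallyFiniteMeasure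
      ((μHE[n - 1] : Measure (EuclideanSpace ℝ (Fin n))).restrict (frontier D)) := by
  refine ⟨fun x => ?_⟩
  by_cases hx : x ∈ frontier D
  · obtain ⟨c, C, -, -, h⟩ := hD.exists_density_bounds hx
    obtain ⟨r, ⟨-, hr⟩, hr0⟩ := (h.and self_mem_nhdsWithin).exists
    refine ⟨closedBall x r, closedBall_mem_nhds x hr0, ?_⟩
    rw [Measure.restrict_apply isClosed_closedBall.measurableSet, inter_comm]
    exact hr.trans_lt ENNReal.ofReal_lt_top
  · refine ⟨(frontier D)ᶜ, isClosed_frontier.isOpen_compl.mem_nhds hx, ?_⟩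
    rw [Measure.restrict_apply isClosed_frontier.measurableSet.compl]
    simp

/-- Testing a locally integrable density against a cutoff function bounds its value at the centre
by the tested integral and the mean oscillation. -/
theorem abs_mul_measureReal_le {X : Type*} [TopologicalSpace X] [MeasurableSpace X] [BorelSpace X]
    {μ : Measure X} {Q φ : X → ℝ} {q : ℝ} {A B : Set X} (hA : MeasurableSet A)
    (hAB : A ⊆ B) (hμB : μ B ≠ ⊤) (hQ : IntegrableOn Q B μ)
    (hφ : Continuous φ) (h0 : ∀ x, 0 ≤ φ x) (h1 : ∀ x, φ x ≤ 1) (hφA : ∀ x ∈ A, φ x = 1)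
    (hφB : ∀ x ∉ B, φ x = 0) :
    |q| * μ.real A ≤ |∫ x, Q x * φ x ∂μ| + ∫ x in B, ‖Q x - q‖ ∂μ := by
  have hb : ∀ x, ‖φ x‖ ≤ 1 := fun x => by
    rw [Real.norm_of_nonneg (h0 x)]; exact h1 x
  have hφi : IntegrableOn φ B μ :=
    Measure.integrableOn_of_bounded hμB hφ.aestronglyMeasurable (.of_forall hb)
  have hqi : IntegrableOn (fun _ => q) B μ := integrableOn_const hμB
  have hQφ : IntegrableOn (fun x => Q x * φ x) B μ :=
    hQ.mul_bdd hφ.aestronglyMeasurable (.of_forall hb)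
  have hdφ : IntegrableOn (fun x => (Q x - q) * φ x) B μ :=
    (hQ.sub hqi).mul_bdd hφ.aestronglyMeasurable (.of_forall hb)
  have hA1 : μ.real A ≤ ∫ x in B, φ x ∂μ := by
    calc μ.real A = ∫ x in A, φ x ∂μ := by
          rw [setIntegral_congr_fun (g := fun _ => (1 : ℝ)) hA hφA]; simp
      _ ≤ _ := setIntegral_mono_set hφi (.of_forall h0) hAB.eventuallyLE
  -- Freezes the density at `q`; the error is the oscillation term.
  have hsplit : q * ∫ x in B, φ x ∂μ =
      (∫ x in B, Q x * φ x ∂μ) - ∫ x in B, (Q x - q) * φ x ∂μ := by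
    rw [← integral_sub hQφ hdφ, ← integral_const_mul]
    congr 1 with x
    ring
  have hdif : |∫ x in B, (Q x - q) * φ x ∂μ| ≤ ∫ x in B, ‖Q x - q‖ ∂μ := by
    refine norm_integral_le_of_norm_le (G := ℝ) (f := fun x => (Q x - q) * φ x)
      (hQ.sub hqi).norm (.of_forall fun x => ?_)
    rw [norm_mul]
    exact mul_le_of_le_one_right (norm_nonneg _) (hb x)
  calc |q| * μ.real A ≤ |q| * ∫ x in B, φ x ∂μ := by gcongr
    _ = |q * ∫ x in B, φ x ∂μ| := by
      rw [abs_mul, abs_of_nonneg (measureReal_nonneg.trans hA1)]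
    _ ≤ |∫ x in B, Q x * φ x ∂μ| + |∫ x in B, (Q x - q) * φ x ∂μ| := by
      rw [hsplit]; exact abs_sub _ _
    _ ≤ _ := by
      rw [setIntegral_eq_integral_of_forall_compl_eq_zero (f := fun x => Q x * φ x)
        fun x hx => by rw [hφB x hx, mul_zero]]
      gcongr

theorem eq_zero_of_isWeakSolution {Ω D : Set (EuclideanSpace ℝ (Fin n))} (hn : 1 ≤ n)
    (hΩ : IsOpen Ω) {β : ℝ≥0} (hD : HasC1HolderBoundary β D)
    {Q v w : EuclideanSpace ℝ (Fin n) → ℝ} (hQ : IntegrableOn Q (frontier D) μHE[n - 1])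
    (hv : IsWeakSolution Ω (frontier D) Q v) (hw : ContDiffOn ℝ 1 w Ω)
    (hwv : w =ᵐ[volume.restrict Ω] v) {x : EuclideanSpace ℝ (Fin n)} (hx : x ∈ frontier D)
    (hxΩ : x ∈ Ω)
    (hleb : Tendsto (fun r => ⨍ y in closedBall x r, ‖Q y - Q x‖ ∂μHE[n - 1].restrict (frontier D))
      (𝓝[>] 0) (𝓝 0)) : Q x = 0 := by
  -- Removes truncated subtraction: volumes scale as `r ^ (d + 1)`, surface measure as `r ^ d`.
  obtain ⟨d, rfl⟩ : ∃ d, n = d + 1 := ⟨n - 1, by omega⟩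
  simp only [Nat.add_sub_cancel] at *
  set μ := (μHE[d] : Measure (EuclideanSpace ℝ (Fin (d + 1)))).restrict (frontier D) with hμ
  obtain ⟨M, hM0, hM⟩ := exists_cutoff_laplacian_le (EuclideanSpace ℝ (Fin (d + 1)))
  obtain ⟨c, C, hc, hC, hden⟩ := hD.exists_density_bounds hx
  simp only [Nat.add_sub_cancel] at hden
  have hdens : ∀ᶠ r in 𝓝[>] (0 : ℝ), c * r ^ d ≤ μ.real (closedBall x r) ∧
      μ.real (closedBall x r) ≤ C * r ^ d ∧ μ (closedBall x r) ≠ ⊤ := by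
    filter_upwards [hden, self_mem_nhdsWithin] with r hr hr0
    have hr0 : 0 < r := hr0
    have e : μ (closedBall x r) = μHE[d] (frontier D ∩ closedBall x r) := by
      rw [hμ, Measure.restrict_apply isClosed_closedBall.measurableSet, inter_comm]
    have hfin : μ (closedBall x r) ≠ ⊤ := (e ▸ hr.2.trans_lt ENNReal.ofReal_lt_top).ne
    rw [← e] at hr
    exact ⟨(ENNReal.ofReal_le_iff_le_toReal hfin).1 hr.1,
      ENNReal.toReal_le_of_le_ofReal (by positivity) hr.2, hfin⟩
  have hhalf : Tendsto (fun r : ℝ => r / 2) (𝓝[>] 0) (𝓝[>] 0) := by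
    refine tendsto_nhdsWithin_iff.2 ⟨?_, ?_⟩
    · have : Tendsto (fun r : ℝ => r / 2) (𝓝 0) (𝓝 (0 / 2)) :=
        (continuous_id.div_const 2).tendsto 0
      rw [zero_div] at this
      exact this.mono_left nhdsWithin_le_nhds
    · filter_upwards [self_mem_nhdsWithin] with r hr using half_pos (mem_Ioi.1 hr)
  have hwx : DifferentiableAt ℝ w x :=
    (hw.contDiffAt (hΩ.mem_nhds hxΩ)).differentiableAt (by norm_num)
  have hwc : ∀ᶠ y in 𝓝 x, ContinuousAt w y := by
    filter_upwards [hΩ.mem_nhds hxΩ] with y hy using hw.continuousOn.continuousAt (hΩ.mem_nhds hy)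
  obtain ⟨ρ, hρ, hball⟩ := Metric.isOpen_iff.1 hΩ x hxΩ
  set W := (volume : Measure (EuclideanSpace ℝ (Fin (d + 1)))).real (ball 0 1) with hW
  have hW0 : 0 ≤ W := measureReal_nonneg
  -- `M * W` comes from the volume side and `C` from the oscillation of `Q`; `c / 2 ^ d` is the
  -- lower density on the half ball where `φ = 1`.
  have main : ∀ ε > 0, |Q x| * (c / 2 ^ d) ≤ ε * (M * W + C) := by
    intro ε hε
    have h1 := eventually_abs_integral_mul_laplacian_le hwx hwc hε
    have h2 : ∀ᶠ r in 𝓝[>] (0 : ℝ),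
        ⨍ y in closedBall x r, ‖Q y - Q x‖ ∂μ < ε := hleb.eventually_lt_const hε
    obtain ⟨r, h1, h2, hd, hd2, hr0, hrρ⟩ := (h1.and (h2.and (hdens.and ((hhalf.eventually
      hdens).and (Ioo_mem_nhdsGT hρ))))).exists
    obtain ⟨φ, hφ, hsupp, hφ0, hφ1, hφeq, hlap⟩ := hM x r hr0
    have hweak := hv.neg_integral_mul_laplacian hΩ hwv hφ
      (hsupp.trans ((closedBall_subset_ball hrρ).trans hball))
    simp only [Nat.add_sub_cancel] at hweak
    have hest := h1 φ _ hφ hsupp hlap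
    rw [← abs_neg, hweak, Measure.addHaar_real_closedBall _ _ hr0.le, ← hW,
      finrank_euclideanSpace_fin] at hest
    have hcmp := abs_mul_measureReal_le (μ := μ) (q := Q x) (A := closedBall x (r / 2))
      isClosed_closedBall.measurableSet
      (closedBall_subset_closedBall (by linarith)) hd.2.2 (Integrable.integrableOn hQ)
      hφ.continuous hφ0 hφ1 hφeq
      (fun y hy => image_eq_zero_of_notMem_tsupport fun h => hy (hsupp h))
    have hosc : ∫ y in closedBall x r, ‖Q y - Q x‖ ∂μ ≤ ε * (C * r ^ d) := by
      have hm : 0 < μ.real (closedBall x r) := lt_of_lt_of_le (by positivity) hd.1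
      rw [setAverage_eq, smul_eq_mul, inv_mul_lt_iff₀ hm, mul_comm] at h2
      exact h2.le.trans (mul_le_mul_of_nonneg_left hd.2.1 hε.le)
    have hlow : |Q x| * (c * (r / 2) ^ d) ≤ |Q x| * μ.real (closedBall x (r / 2)) :=
      mul_le_mul_of_nonneg_left hd2.1 (abs_nonneg _)
    have hrd : 0 < r ^ d := by positivity
    -- The powers `r · r⁻² · r ^ (d + 1)` combine to exactly `r ^ d`, the surface scaling.
    have e1 : ε * r * (M / r ^ 2) * (r ^ (d + 1) * W) = ε * (M * W) * r ^ d := by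
      field_simp
      ring
    have e2 : |Q x| * (c * (r / 2) ^ d) = |Q x| * (c / 2 ^ d) * r ^ d := by
      rw [div_pow]; ring
    refine le_of_mul_le_mul_right ?_ hrd
    rw [e1] at hest
    rw [e2] at hlow
    linarith
  have hle : |Q x| * (c / 2 ^ d) ≤ 0 := by
    refine le_of_forall_pos_le_add fun ε hε => ?_
    have hpos : 0 < M * W + C := by positivity
    have := main (ε / (M * W + C)) (by positivity)
    rwa [div_mul_cancel₀ _ hpos.ne', ← zero_add ε] at this
  have hc' : 0 < c / 2 ^ d := by positivity
  exact abs_nonpos_iff.1 (nonpos_of_mul_nonpos_left hle hc')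

end WeakSolutions

theorem mainTheorem5 (n : ℕ) (hn : 1 ≤ n)
    (Ω Ω' : Set (EuclideanSpace ℝ (Fin n)))
    (hΩ_open : IsOpen Ω) (hΩ_conn : IsConnected Ω) (hΩ_bdd : Bornology.IsBounded Ω)
    (hΩ'_open : IsOpen Ω') (hΩ'_conn : IsConnected Ω') (hΩ'_sub : closure Ω' ⊆ Ω)
    (β : ℝ≥0) (hβ_pos : 0 < β) (hβ_lt : β < 1) (hΩ'_bdry : HasC1HolderBoundary β Ω')
    (Q v : EuclideanSpace ℝ (Fin n) → ℝ)
    (hQ : IntegrableOn Q (frontier Ω') μHE[n - 1])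
    (hv : IsWeakSolution Ω (frontier Ω') Q v)
    (hQ_ne : ¬ Q =ᵐ[μHE[n - 1].restrict (frontier Ω')] 0) :
    ¬ ∃ w : EuclideanSpace ℝ (Fin n) → ℝ,
      ContDiffOn ℝ 1 w Ω ∧ w =ᵐ[volume.restrict Ω] v := by
  rintro ⟨w, hw, hwv⟩
  refine hQ_ne ?_
  have := hΩ'_bdry.isLocallyFiniteMeasure
  have hleb := (Besicovitch.vitaliFamily
    ((μHE[n - 1] : Measure (EuclideanSpace ℝ (Fin n))).restrict
      (frontier Ω'))).ae_tendsto_average_norm_sub (Integrable.locallyIntegrable hQ)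
  filter_upwards [hleb, ae_restrict_mem isClosed_frontier.measurableSet] with x hx hxΓ
  exact eq_zero_of_isWeakSolution hn hΩ_open hΩ'_bdry hQ hv hw hwv hxΓ
    (hΩ'_sub (frontier_subset_closure hxΓ)) (hx.comp (Besicovitch.tendsto_filterAt _ x))
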